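/- Let $(0,0)=p_0,p_1,\dots,p_m=(1,1)$ be the consecutive vertices of a strictly convex polygonal curve in $[0,1]^2$, with strictly increasing abscissae and strictly increasing slopes (the known points of a Lorenz curve). Consider all convex curves through $p_0,\dots,p_m$, i.e. graphs of convex functions $L:[0,1]\to[0,\infty)$ with $L(0)=0$, $L(1)=1$ that pass through all $p_i$ (a jump of $L$ at $1$ is allowed and is regarded as a vertical segment of the curve on the line $x=1$). Such a curve is called *optimal* if its Gini coefficient $\mathcal G(L)=2\int_0^1 (x-L(x))\,dx$, twice the area between the diagonal and the curve, is maximal among all these curves. The side $S_i=p_ip_{i+1}$ is *used* (U) by the curve if it is contained in the curve, and *not used* (N) otherwise; this assigns to the curve a sequence in $\{U,N\}^m$. Farris conjectured that for all such points the maximum is attained at a convex polygonal curve each of whose sides lies on one of the lines $p_ip_{i+1}$ (apart from sides lying on the sides $y=0$ and $x=1$ of the unit square); equivalently, at a convex polygonal curve whose sequence contains no two consecutive $N$s. Both forms of the conjecture are false. Specifically, let $n\ge 5$ with $8\mid n-4$, and consider the regular $n$-gon centered at $(0,1)$ with a vertex at $(0,0)$. Its vertices in $[0,1]^2$ are $p_k=\left(\sin\frac{2\pi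 k}{n},\,1-\cos\frac{2\pi k}{n}\right)$, $0\le k\le n/4$; they satisfy the above conditions. For these points an optimal curve exists, and every optimal curve is polygonal and uses none of the sides $S_i$; in particular its sequence contains two consecutive $N$s, and it has a side which lies neither on a line $p_ip_{i+1}$ nor on a side of the unit square. -/

import Mathlib

open Set

noncomputable section

/-- A convex curve in the unit square joining `(0,0)` to `(1,1)`, given as the graph over `[0,1]` of a
nonnegative convex function `L` with `L 0 = 0` and `L 1 = 1`. (Such an `L` takes values in `[0,1]`, is
nondecreasing, and is continuous except possibly at `1`; a jump at `1` is a vertical last segment of the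
curve, on the side `x = 1` of the square.) Values outside `[0,1]` are irrelevant. -/
structure IsLorenzCurve (L : ℝ → ℝ) : Prop where
  convexOn : ConvexOn ℝ (Icc 0 1) L
  nonneg : ∀ x ∈ Icc (0 : ℝ) 1, 0 ≤ L x
  map_zero : L 0 = 0
  map_one : L 1 = 1

/-- The Gini coefficient: twice the area between the neutral line and the curve. -/
def gini (L : ℝ → ℝ) : ℝ := 2 * ∫ x in (0 : ℝ)..1, (x - L x)

/-- The slope of the `i`-th side `p i, p (i+1)` of the polygonal curve with vertices `p`. -/
def sideSlope {m : ℕ} (p : Fin (m + 1) → ℝ × ℝ) (i : Fin m) : ℝ :=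
  ((p i.succ).2 - (p i.castSucc).2) / ((p i.succ).1 - (p i.castSucc).1)

/-- Finitely many given points of a Lorenz curve, from `(0,0)` to `(1,1)`: the vertices, in order, of a
strictly convex polygonal curve. -/
structure IsLorenzData {m : ℕ} (p : Fin (m + 1) → ℝ × ℝ) : Prop where
  first : p 0 = (0, 0)
  last : p (Fin.last m) = (1, 1)
  nonneg : ∀ i, 0 ≤ (p i).2
  strictMono_fst : StrictMono fun i => (p i).1
  strictMono_slope : StrictMono (sideSlope p)

/-- `L` is a convex curve through all the given points. -/
def IsCircumscribed {m : ℕ} (p : Fin (m + 1) → ℝ × ℝ) (L : ℝ → ℝ) : Prop :=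
  IsLorenzCurve L ∧ ∀ i, L (p i).1 = (p i).2

/-- `L` has the largest Gini coefficient (equivalently, encloses the largest area with the neutral
line) among all convex curves through the given points. -/
def IsOptimal {m : ℕ} (p : Fin (m + 1) → ℝ × ℝ) (L : ℝ → ℝ) : Prop :=
  IsCircumscribed p L ∧ ∀ M : ℝ → ℝ, IsCircumscribed p M → gini M ≤ gini L

/-- The curve consists of finitely many straight segments (besides a possible vertical one at
`x = 1`). -/
def IsPolygonal (L : ℝ → ℝ) : Prop :=
  ∃ (N : ℕ) (t : ℕ → ℝ), t 0 = 0 ∧ t N = 1 ∧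
    ∀ j < N, t j < t (j + 1) ∧
      ∃ s c : ℝ, ∀ x ∈ Ioo (t j) (t (j + 1)), L x = s * x + c

/-- The `i`-th side of the polygonal curve with vertices `p` is used by `L` (letter `U`): it is
contained in the curve. Otherwise it is not used (letter `N`). -/
def Used {m : ℕ} (p : Fin (m + 1) → ℝ × ℝ) (L : ℝ → ℝ) (i : Fin m) : Prop :=
  segment ℝ (p i.castSucc) (p i.succ) ⊆ {z : ℝ × ℝ | z.2 = L z.1}

/-- The sequence of `U`s and `N`s assigned to `L` contains two consecutive `N`s. -/
def HasConsecutiveN {m : ℕ} (p : Fin (m + 1) → ℝ × ℝ) (L : ℝ → ℝ) : Prop :=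
  ∃ i j : Fin m, (j : ℕ) = (i : ℕ) + 1 ∧ ¬ Used p L i ∧ ¬ Used p L j

/-- Each side of the curve `L` lies on a sideline of the polygonal curve with vertices `p` or on a side
of the unit square: whenever `L` is given by `y = s x + c` on a nondegenerate interval, the line
`y = s x + c` is the `x`-axis or passes through two consecutive points of `p`. (A vertical last side
lies on the side `x = 1` of the square.) -/
def SidesOnSidelines {m : ℕ} (p : Fin (m + 1) → ℝ × ℝ) (L : ℝ → ℝ) : Prop :=
  ∀ a b s c : ℝ, 0 ≤ a → a < b → b ≤ 1 → (∀ x ∈ Ioo a b, L x = s * x + c) →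
    (s = 0 ∧ c = 0) ∨
    ∃ i : Fin m, (p i.castSucc).2 = s * (p i.castSucc).1 + c ∧ (p i.succ).2 = s * (p i.succ).1 + c

/-- Farris' conjecture, in terms of sidelines: the maximal value is attained at a convex polygonal
curve each side of which lies on a sideline of the polygonal curve connecting the given points. -/
def FarrisConjectureSidelines : Prop :=
  ∀ (m : ℕ) (p : Fin (m + 1) → ℝ × ℝ), IsLorenzData p →
    ∃ L : ℝ → ℝ, IsOptimal p L ∧ IsPolygonal L ∧ SidesOnSidelines p L

/-- Farris' conjecture, in terms of sequences: the maximal value is attained at a convex polygonal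
curve whose sequence of `U`s and `N`s has no two consecutive `N`s. -/
def FarrisConjectureSequences : Prop :=
  ∀ (m : ℕ) (p : Fin (m + 1) → ℝ × ℝ), IsLorenzData p →
    ∃ L : ℝ → ℝ, IsOptimal p L ∧ IsPolygonal L ∧ ¬ HasConsecutiveN p L

/-- The vertices, in counterclockwise order, of the regular `n`-gon with center `(0,1)` and the vertex
`(0,0)`, starting from `(0,0)`. -/
def regularVertex (n k : ℕ) : ℝ × ℝ :=
  (Real.sin (2 * Real.pi * k / n), 1 - Real.cos (2 * Real.pi * k / n))

/-- The first `n / 4 + 1` vertices of that polygon. For `4 ∣ n` they are those in the unit square. -/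
def regularArc (n : ℕ) (k : Fin (n / 4 + 1)) : ℝ × ℝ := regularVertex n k

end

/-!
A supporting line of a convex function at the midpoint of an interval bounds its integral over that
interval from below by the length times the value at the midpoint, whatever the slope of the line.
The corners of the polygon cut out by `y = 0`, `x = 1` and the tangents at the vertices lie at equal
distances from the centre of the circle, so each side between two corners touches the circle at its
midpoint. Above the remaining side, on `y = 0`, a Lorenz curve is nonnegative. Hence a convex curve
through the vertices has at least the area of the polygon below it, and in case of equality it is
affine over each side; continuity at the corners then forces the slopes to be those of the tangents.
The slope of a chord is the tangent of an odd multiple of half a step, and so differs from the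
slopes at the vertices.
-/

noncomputable section

open Real MeasureTheory

/-! ### Convex functions of a real variable -/

lemma exists_affine_le_of_convexOn {S : Set ℝ} {f : ℝ → ℝ} (hf : ConvexOn ℝ S f) {p : ℝ}
    (hp : p ∈ interior S) : ∃ σ : ℝ, ∀ x ∈ S, f p + σ * (x - p) ≤ f x := by
  refine ⟨derivWithin f (Ioi p) p, fun x hx => ?_⟩
  rcases lt_trichotomy p x with h | rfl | h
  · have hσ := hf.rightDeriv_le_slope_of_mem_interior hp hx h
    rw [slope_def_field, le_div_iff₀ (sub_pos.2 h)] at hσ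
    linarith
  · simp
  · have hσ := (hf.slope_le_leftDeriv_of_mem_interior hx hp h).trans
      (hf.leftDeriv_le_rightDeriv_of_mem_interior hp)
    rw [slope_def_field, div_le_iff₀ (sub_pos.2 h)] at hσ
    linarith

lemma convexOn_update_of_mem_extremePoints {𝕜 E β : Type*} [Semiring 𝕜] [PartialOrder 𝕜]
    [AddCommMonoid E] [Module 𝕜 E] [DecidableEq E] [AddCommMonoid β] [PartialOrder β]
    [IsOrderedAddMonoid β] [Module 𝕜 β] [PosSMulMono 𝕜 β] {S : Set E} {f : E → β}
    (hf : ConvexOn 𝕜 S f) {p : E} (hp : p ∈ S.extremePoints 𝕜) {y : β} (hy : f p ≤ y) :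
    ConvexOn 𝕜 S (Function.update f p y) := by
  have hle : f ≤ Function.update f p y := le_update_self_iff.2 hy
  refine convexOn_iff_forall_pos.2 ⟨hf.1, fun u hu v hv a b ha hb hab => ?_⟩
  by_cases huv : a • u + b • v = p
  · obtain ⟨rfl, rfl⟩ := (mem_extremePoints.1 hp).2 u hu v hv ⟨a, b, ha, hb, hab, huv⟩
    simp only [huv, Function.update_self, ← add_smul, hab, one_smul, le_refl]
  · calc Function.update f p y (a • u + b • v) = f (a • u + b • v) := Function.update_of_ne huv ..
      _ ≤ a • f u + b • f v := hf.2 hu hv ha.le hb.le hab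
      _ ≤ a • Function.update f p y u + b • Function.update f p y v := by
        gcongr
        exacts [hle u, hle v]

lemma convexOn_iSup_of_finite {E ι : Type*} [AddCommGroup E] [Module ℝ E] [Finite ι]
    [Nonempty ι] {S : Set E} {f : ι → E → ℝ} (hf : ∀ i, ConvexOn ℝ S (f i)) :
    ConvexOn ℝ S fun x => ⨆ i, f i x := by
  have hle (x : E) (i : ι) : f i x ≤ ⨆ j, f j x := le_ciSup (finite_range fun j => f j x).bddAbove i
  refine ⟨(hf (Classical.arbitrary ι)).1, fun u hu v hv a b ha hb hab => ciSup_le fun i => ?_⟩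
  refine ((hf i).2 hu hv ha hb hab).trans ?_
  gcongr
  exacts [hle u i, hle v i]

lemma integral_affine_midpoint (a b y σ : ℝ) :
    ∫ x in a..b, (y + σ * (x - (a + b) / 2)) = (b - a) * y := by
  rw [intervalIntegral.integral_add (by simp) (Continuous.intervalIntegrable (by fun_prop) _ _),
    intervalIntegral.integral_const_mul, intervalIntegral.integral_sub (by simp) (by simp)]
  simp only [intervalIntegral.integral_const, integral_id, smul_eq_mul]
  ring

lemma eqOn_Ioo_of_le_of_integral_le {f g : ℝ → ℝ} {a b : ℝ} (hab : a ≤ b)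
    (hf : ContinuousOn f (Ioo a b)) (hg : ContinuousOn g (Ioo a b))
    (hfi : IntervalIntegrable f volume a b) (hgi : IntervalIntegrable g volume a b)
    (hle : ∀ x ∈ Ioo a b, f x ≤ g x) (hint : ∫ x in a..b, g x ≤ ∫ x in a..b, f x) :
    EqOn f g (Ioo a b) := by
  have hint' := hint.antisymm (intervalIntegral.integral_mono_on_of_le_Ioo hab hfi hgi hle)
  rw [intervalIntegral.integral_of_le hab, intervalIntegral.integral_of_le hab,
    integral_Ioc_eq_integral_Ioo, integral_Ioc_eq_integral_Ioo] at hint'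
  rw [intervalIntegrable_iff_integrableOn_Ioo_of_le hab] at hfi hgi
  exact Measure.eqOn_open_of_ae_eq ((integral_eq_iff_of_ae_le hfi hgi
    ((ae_restrict_iff' measurableSet_Ioo).2 (.of_forall hle))).1 hint'.symm) isOpen_Ioo hf hg

lemma eq_of_eqOn_Ioo_of_continuousAt {f g h : ℝ → ℝ} {a b c : ℝ} (hab : a < b) (hbc : b < c)
    (hf : ContinuousAt f b) (hg : ContinuousAt g b) (hh : ContinuousAt h b)
    (hfg : EqOn f g (Ioo a b)) (hfh : EqOn f h (Ioo b c)) : g b = h b := by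
  have hgb : f b = g b := tendsto_nhds_unique_of_eventuallyEq
    (hf.tendsto.mono_left nhdsWithin_le_nhds) (hg.tendsto.mono_left nhdsWithin_le_nhds)
    (Filter.eventually_of_mem (Ioo_mem_nhdsLT hab) hfg)
  have hhb : f b = h b := tendsto_nhds_unique_of_eventuallyEq
    (hf.tendsto.mono_left nhdsWithin_le_nhds) (hh.tendsto.mono_left nhdsWithin_le_nhds)
    (Filter.eventually_of_mem (Ioo_mem_nhdsGT hbc) hfh)
  exact hgb.symm.trans hhb

/-! ### Lorenz curves -/

lemma IsLorenzCurve.monotoneOn {L : ℝ → ℝ} (hL : IsLorenzCurve L) : MonotoneOn L (Icc 0 1) := by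
  intro x hx y hy hxy
  rcases hx.1.eq_or_lt with rfl | hx0
  · exact hL.map_zero.trans_le (hL.nonneg y hy)
  have hy0 : 0 < y := hx0.trans_le hxy
  have hxy1 : x / y ≤ 1 := div_le_one_of_le₀ hxy hy0.le
  have hconv := hL.convexOn.2 (left_mem_Icc.2 zero_le_one) hy (sub_nonneg.2 hxy1)
    (by positivity : 0 ≤ x / y) (by ring)
  simp only [smul_eq_mul, mul_zero, zero_add, hL.map_zero, div_mul_cancel₀ _ hy0.ne'] at hconv
  exact hconv.trans (mul_le_of_le_one_left (hL.nonneg y hy) hxy1)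

lemma IsLorenzCurve.intervalIntegrable {L : ℝ → ℝ} (hL : IsLorenzCurve L) {a b : ℝ}
    (ha : a ∈ Icc (0 : ℝ) 1) (hb : b ∈ Icc (0 : ℝ) 1) : IntervalIntegrable L volume a b :=
  (hL.monotoneOn.mono (uIcc_subset_Icc ha hb)).intervalIntegrable

lemma IsLorenzCurve.continuousOn {L : ℝ → ℝ} (hL : IsLorenzCurve L) :
    ContinuousOn L (Ioo 0 1) :=
  interior_Icc (a := (0 : ℝ)) ▸ hL.convexOn.continuousOn_interior

lemma IsLorenzCurve.gini_eq {L : ℝ → ℝ} (hL : IsLorenzCurve L) :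
    gini L = 1 - 2 * ∫ x in (0 : ℝ)..1, L x := by
  rw [gini, intervalIntegral.integral_sub (by simp) (hL.intervalIntegrable (by simp) (by simp)),
    integral_id]
  ring

lemma IsLorenzCurve.exists_affine_le {L : ℝ → ℝ} (hL : IsLorenzCurve L) {p : ℝ}
    (hp : p ∈ Ico (0 : ℝ) 1) :
    ∃ σ : ℝ, (p = 0 → σ = 0) ∧ ∀ x ∈ Icc (0 : ℝ) 1, L p + σ * (x - p) ≤ L x := by
  rcases hp.1.eq_or_lt with rfl | hp0
  · exact ⟨0, fun _ => rfl, fun x hx => by simpa [hL.map_zero] using hL.nonneg x hx⟩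
  · obtain ⟨σ, hσ⟩ := exists_affine_le_of_convexOn hL.convexOn (p := p)
      (by rw [interior_Icc]; exact ⟨hp0, hp.2⟩)
    exact ⟨σ, fun h => absurd h hp0.ne', hσ⟩

lemma sideSlope_eq_of_line {m : ℕ} {p : Fin (m + 1) → ℝ × ℝ} {i : Fin m}
    (hp : (p i.castSucc).1 < (p i.succ).1) {s c : ℝ}
    (hleft : (p i.castSucc).2 = s * (p i.castSucc).1 + c)
    (hright : (p i.succ).2 = s * (p i.succ).1 + c) : sideSlope p i = s := by
  rw [sideSlope, div_eq_iff (sub_pos.2 hp).ne', hleft, hright]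
  ring

lemma Used.apply_eq {m : ℕ} {p : Fin (m + 1) → ℝ × ℝ} {L : ℝ → ℝ} {i : Fin m}
    (hu : Used p L i) (hp : (p i.castSucc).1 < (p i.succ).1) {x : ℝ}
    (hx : x ∈ Icc (p i.castSucc).1 (p i.succ).1) :
    L x = (p i.castSucc).2 + sideSlope p i * (x - (p i.castSucc).1) := by
  set q := p i.castSucc
  set r := p i.succ
  have hqr : r.1 - q.1 ≠ 0 := (sub_pos.2 hp).ne'
  have hxt : (x - q.1) / (r.1 - q.1) ∈ Icc (0 : ℝ) 1 :=
    ⟨div_nonneg (sub_nonneg.2 hx.1) (sub_pos.2 hp).le,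
      div_le_one_of_le₀ (by linarith [hx.2]) (sub_pos.2 hp).le⟩
  have hmem : q + ((x - q.1) / (r.1 - q.1)) • (r - q) ∈ segment ℝ q r := by
    rw [segment_eq_image']
    exact mem_image_of_mem _ hxt
  have hfst : (q + ((x - q.1) / (r.1 - q.1)) • (r - q)).1 = x := by
    simp [div_mul_cancel₀ _ hqr]
  have hval := hu hmem
  rw [mem_ofPred_eq, hfst] at hval
  rw [← hval, sideSlope]
  simp only [Prod.snd_add, Prod.smul_snd, Prod.snd_sub, smul_eq_mul]
  ring

/-! ### Chords and tangents of the circle -/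

lemma le_pi_div_two_of_sin_nonneg_of_cos_nonneg {θ : ℝ} (hθ : θ < 2 * π) (hsin : 0 ≤ sin θ)
    (hcos : 0 ≤ cos θ) : θ ≤ π / 2 := by
  by_contra! h
  rcases lt_or_ge θ (π + π / 2) with h' | h'
  · exact (cos_neg_of_pi_div_two_lt_of_lt h h').not_ge hcos
  · have hneg : sin (θ - 2 * π) < 0 :=
      sin_neg_of_neg_of_neg_pi_lt (by linarith) (by linarith [pi_pos])
    rw [sin_sub_two_pi] at hneg
    exact hneg.not_ge hsin

lemma one_sub_cos_sub_div_sin_sub {θ φ : ℝ} (h : sin ((φ - θ) / 2) ≠ 0) :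
    ((1 - cos φ) - (1 - cos θ)) / (sin φ - sin θ) = tan ((φ + θ) / 2) := by
  have hnum : (1 - cos φ) - (1 - cos θ) = 2 * sin ((φ - θ) / 2) * sin ((φ + θ) / 2) := by
    linear_combination -cos_sub_cos φ θ
  rw [hnum, sin_sub_sin, mul_div_mul_left _ _ (mul_ne_zero two_ne_zero h), tan_eq_sin_div_cos]

/-- The tangent of the unit circle with centre `(0, 1)` at the point `(sin θ, 1 - cos θ)`, as a
function of the abscissa. The formula is meaningful for `cos θ ≠ 0`. -/
def circleTangent (θ x : ℝ) : ℝ := 1 - cos θ + tan θ * (x - sin θ)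

lemma continuous_circleTangent (θ : ℝ) : Continuous (circleTangent θ) := by
  unfold circleTangent
  fun_prop

lemma convexOn_circleTangent (θ : ℝ) {S : Set ℝ} (hS : Convex ℝ S) :
    ConvexOn ℝ S (circleTangent θ) := by
  refine ⟨hS, fun x _ y _ a b _ _ hab => le_of_eq ?_⟩
  simp only [circleTangent, smul_eq_mul]
  linear_combination (1 - cos θ - tan θ * sin θ) * hab.symm

lemma circleTangent_zero (x : ℝ) : circleTangent 0 x = 0 := by simp [circleTangent]

lemma circleTangent_sin_self (θ : ℝ) : circleTangent θ (sin θ) = 1 - cos θ := by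
  simp [circleTangent]

lemma cos_mul_sub_circleTangent {θ : ℝ} (hθ : 0 < cos θ) (x y : ℝ) :
    cos θ * (y - circleTangent θ x) = 1 - (sin θ * x + cos θ * (1 - y)) := by
  have htan : cos θ * tan θ = sin θ := by rw [mul_comm, tan_mul_cos hθ.ne']
  rw [circleTangent]
  linear_combination (sin θ - x) * htan + sin_sq_add_cos_sq θ

lemma circleTangent_le_iff {θ : ℝ} (hθ : 0 < cos θ) {x y : ℝ} :
    circleTangent θ x ≤ y ↔ sin θ * x + cos θ * (1 - y) ≤ 1 := by
  rw [← sub_nonneg, ← mul_nonneg_iff_of_pos_left hθ, cos_mul_sub_circleTangent hθ, sub_nonneg]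

lemma circleTangent_eq_iff {θ : ℝ} (hθ : 0 < cos θ) {x y : ℝ} :
    circleTangent θ x = y ↔ sin θ * x + cos θ * (1 - y) = 1 := by
  rw [eq_comm, ← sub_eq_zero, ← mul_eq_zero_iff_left hθ.ne', cos_mul_sub_circleTangent hθ,
    sub_eq_zero, eq_comm]

lemma circleTangent_sin_le {θ : ℝ} (hθ : 0 < cos θ) (φ : ℝ) :
    circleTangent θ (sin φ) ≤ 1 - cos φ := by
  rw [circleTangent_le_iff hθ, sub_sub_cancel, add_comm, ← cos_sub]
  exact cos_le_one _

lemma sin_mul_div_cos_add_cos_mul (θ γ η : ℝ) :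
    sin θ * (sin γ / cos η) + cos θ * (1 - (1 - cos γ / cos η)) = cos (θ - γ) / cos η := by
  rw [cos_sub]
  ring

/-- `(sin γ / cos η, 1 - cos γ / cos η)` is where the tangents at `γ - η` and `γ + η` meet. -/
lemma circleTangent_sin_div_cos_le_iff {θ γ η : ℝ} (hθ : 0 < cos θ) (hη : 0 < cos η) :
    circleTangent θ (sin γ / cos η) ≤ 1 - cos γ / cos η ↔ cos (θ - γ) ≤ cos η := by
  rw [circleTangent_le_iff hθ, sin_mul_div_cos_add_cos_mul, div_le_one hη]

lemma circleTangent_sin_div_cos_eq_iff {θ γ η : ℝ} (hθ : 0 < cos θ) (hη : 0 < cos η) :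
    circleTangent θ (sin γ / cos η) = 1 - cos γ / cos η ↔ cos (θ - γ) = cos η := by
  rw [circleTangent_eq_iff hθ, sin_mul_div_cos_add_cos_mul, div_eq_one_iff_eq hη.ne']

/-! ### The angles of the vertices and the knots of the tangent polygon -/

/-- The angle of the `t`-th vertex when the quarter circle is divided into `m` equal arcs. The
index `t` is real: `k + 1 / 2` gives the midpoint of the `k`-th arc, and `1 / 2` half a step. -/
def arcAngle (m : ℕ) (t : ℝ) : ℝ := π / 2 * (t / m)

/-- The abscissae of the corners of the polygon cut out by `y = 0`, by `x = 1` and by the tangents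
at the vertices: the tangents at the vertices `k` and `k + 1` meet above `tangentKnot m (k + 1)`. -/
def tangentKnot (m : ℕ) : ℕ → ℝ
  | 0 => 0
  | k + 1 => sin (arcAngle m (k + 1 / 2)) / cos (arcAngle m (1 / 2))

variable {m : ℕ}

lemma arcAngle_zero (m : ℕ) : arcAngle m 0 = 0 := by simp [arcAngle]

lemma arcAngle_add (m : ℕ) (s t : ℝ) : arcAngle m (s + t) = arcAngle m s + arcAngle m t := by
  simp only [arcAngle]
  ring

lemma arcAngle_sub (m : ℕ) (s t : ℝ) : arcAngle m (s - t) = arcAngle m s - arcAngle m t := by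
  simp only [arcAngle]
  ring

lemma arcAngle_self (hm : 0 < m) : arcAngle m m = π / 2 := by
  have hm' : (m : ℝ) ≠ 0 := by positivity
  rw [arcAngle, div_self hm', mul_one]

lemma strictMono_arcAngle (hm : 0 < m) : StrictMono (arcAngle m) := fun s t hst => by
  have : (0 : ℝ) < m := by positivity
  have := pi_pos
  unfold arcAngle
  gcongr

lemma arcAngle_mem_Icc {t : ℝ} (h0 : 0 ≤ t) (h1 : t ≤ m) : arcAngle m t ∈ Icc 0 (π / 2) := by
  have := pi_pos
  refine ⟨by unfold arcAngle; positivity, ?_⟩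
  exact mul_le_of_le_one_right (by positivity) (div_le_one_of_le₀ h1 m.cast_nonneg)

lemma arcAngle_mem_Ico {t : ℝ} (h0 : 0 ≤ t) (h1 : t < m) : arcAngle m t ∈ Ico 0 (π / 2) := by
  have hm : 0 < m := by exact_mod_cast h0.trans_lt h1
  exact ⟨(arcAngle_mem_Icc h0 h1.le).1, arcAngle_self hm ▸ strictMono_arcAngle hm h1⟩

lemma arcAngle_mem_Ioo_neg {t : ℝ} (h0 : 0 ≤ t) (h1 : t < m) :
    arcAngle m t ∈ Ioo (-(π / 2)) (π / 2) :=
  ⟨(neg_lt_zero.2 pi_div_two_pos).trans_le (arcAngle_mem_Ico h0 h1).1, (arcAngle_mem_Ico h0 h1).2⟩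

lemma arcAngle_natCast_mem_Icc {k : ℕ} (hk : k ≤ m) : arcAngle m k ∈ Icc 0 (π / 2) :=
  arcAngle_mem_Icc k.cast_nonneg (mod_cast hk)

lemma cos_arcAngle_natCast_nonneg {k : ℕ} (hk : k ≤ m) : 0 ≤ cos (arcAngle m k) := by
  have hθ := arcAngle_natCast_mem_Icc hk
  exact cos_nonneg_of_neg_pi_div_two_le_of_le (by linarith [hθ.1, pi_pos]) hθ.2

lemma sin_arcAngle_natCast_nonneg {k : ℕ} (hk : k ≤ m) : 0 ≤ sin (arcAngle m k) := by
  have hθ := arcAngle_natCast_mem_Icc hk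
  exact sin_nonneg_of_nonneg_of_le_pi hθ.1 (by linarith [hθ.2, pi_pos])

lemma cos_arcAngle_pos {t : ℝ} (h0 : 0 ≤ t) (h1 : t < m) : 0 < cos (arcAngle m t) :=
  cos_pos_of_mem_Ioo (arcAngle_mem_Ioo_neg h0 h1)

lemma cos_arcAngle_natCast_pos {k : ℕ} (hk : k < m) : 0 < cos (arcAngle m k) :=
  cos_arcAngle_pos k.cast_nonneg (mod_cast hk)

lemma natCast_add_half_lt {k : ℕ} (hk : k < m) : (k : ℝ) + 1 / 2 < m := by
  linarith [(mod_cast hk : (k : ℝ) + 1 ≤ m)]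

lemma half_lt_natCast (hm : 0 < m) : (1 / 2 : ℝ) < m := by
  simpa using natCast_add_half_lt hm

lemma cos_arcAngle_half_pos (hm : 0 < m) : 0 < cos (arcAngle m (1 / 2)) :=
  cos_arcAngle_pos (by norm_num) (half_lt_natCast hm)

lemma sin_arcAngle_half_pos (hm : 0 < m) : 0 < sin (arcAngle m (1 / 2)) := by
  refine sin_pos_of_pos_of_lt_pi ?_ ?_
  · exact arcAngle_zero m ▸ strictMono_arcAngle hm one_half_pos
  · exact (arcAngle_mem_Ico (by norm_num) (half_lt_natCast hm)).2.trans (half_lt_self pi_pos)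

lemma tan_arcAngle_half_pos (hm : 0 < m) : 0 < tan (arcAngle m (1 / 2)) := by
  rw [tan_eq_sin_div_cos]
  exact div_pos (sin_arcAngle_half_pos hm) (cos_arcAngle_half_pos hm)

lemma sin_arcAngle_natCast_mem_Ico {k : ℕ} (hk : k < m) : sin (arcAngle m k) ∈ Ico (0 : ℝ) 1 := by
  have h := arcAngle_mem_Ico k.cast_nonneg (Nat.cast_lt (α := ℝ).2 hk)
  refine ⟨sin_arcAngle_natCast_nonneg hk.le, ?_⟩
  rw [← sin_pi_div_two]
  exact sin_lt_sin_of_lt_of_le_pi_div_two (by linarith [h.1, pi_pos]) le_rfl h.2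

lemma tan_arcAngle_add_half_ne {i j : ℕ} (hi : i < m) (hj : j < m) :
    tan (arcAngle m (i + 1 / 2)) ≠ tan (arcAngle m j) := fun h => by
  have hij : (i : ℝ) + 1 / 2 = j := (strictMono_arcAngle (i.zero_le.trans_lt hi)).injective <|
    injOn_tan (arcAngle_mem_Ioo_neg (by positivity) (natCast_add_half_lt hi))
      (arcAngle_mem_Ioo_neg j.cast_nonneg (mod_cast hj)) h
  have hparity : 2 * i + 1 = 2 * j := by
    exact_mod_cast (by linarith : 2 * (i : ℝ) + 1 = 2 * j)
  omega

lemma tangentKnot_succ (hm : 0 < m) (k : ℕ) : tangentKnot m (k + 1) =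
    sin (arcAngle m k) + cos (arcAngle m k) * tan (arcAngle m (1 / 2)) := by
  rw [tangentKnot, arcAngle_add, sin_add, add_div, mul_div_cancel_right₀ _
    (cos_arcAngle_half_pos hm).ne', mul_div_assoc, ← tan_eq_sin_div_cos]

lemma tangentKnot_of_ne_zero (hm : 0 < m) {k : ℕ} (hk : k ≠ 0) : tangentKnot m k =
    sin (arcAngle m k) - cos (arcAngle m k) * tan (arcAngle m (1 / 2)) := by
  obtain ⟨k, rfl⟩ := Nat.exists_eq_succ_of_ne_zero hk
  have hk' : (k : ℝ) + 1 / 2 = (k + 1 : ℕ) - 1 / 2 := by push_cast; ring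
  rw [tangentKnot, hk', arcAngle_sub, sin_sub, sub_div, mul_div_cancel_right₀ _
    (cos_arcAngle_half_pos hm).ne', mul_div_assoc, ← tan_eq_sin_div_cos]

/-- The two tangent segments from a point to a circle have equal length, and consecutive corners of
the tangent polygon are at equal distances from the centre. -/
lemma midpoint_tangentKnot (hm : 0 < m) {k : ℕ} (hk : k ≠ 0) :
    (tangentKnot m k + tangentKnot m (k + 1)) / 2 = sin (arcAngle m k) := by
  rw [tangentKnot_of_ne_zero hm hk, tangentKnot_succ hm]
  ring

lemma tangentKnot_self (hm : 0 < m) : tangentKnot m m = 1 := by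
  rw [tangentKnot_of_ne_zero hm hm.ne', arcAngle_self hm, sin_pi_div_two, cos_pi_div_two]
  ring

lemma sin_arcAngle_lt_tangentKnot_succ {k : ℕ} (hk : k < m) :
    sin (arcAngle m k) < tangentKnot m (k + 1) := by
  have hm : 0 < m := k.zero_le.trans_lt hk
  rw [tangentKnot_succ hm, lt_add_iff_pos_right]
  exact mul_pos (cos_arcAngle_natCast_pos hk) (tan_arcAngle_half_pos hm)

lemma tangentKnot_le_sin_arcAngle {k : ℕ} (hk : k ≤ m) : tangentKnot m k ≤ sin (arcAngle m k) := by
  rcases eq_or_ne k 0 with rfl | hk0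
  · simp [tangentKnot, arcAngle_zero]
  · have hm : 0 < m := (Nat.pos_of_ne_zero hk0).trans_le hk
    rw [tangentKnot_of_ne_zero hm hk0, sub_le_self_iff]
    exact mul_nonneg (cos_arcAngle_natCast_nonneg hk) (tan_arcAngle_half_pos hm).le

lemma tangentKnot_lt_succ {k : ℕ} (hk : k < m) : tangentKnot m k < tangentKnot m (k + 1) :=
  (tangentKnot_le_sin_arcAngle hk.le).trans_lt (sin_arcAngle_lt_tangentKnot_succ hk)

lemma strictMonoOn_tangentKnot (m : ℕ) : StrictMonoOn (tangentKnot m) (Iic m) :=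
  strictMonoOn_of_lt_succ ordConnected_Iic fun _ _ _ h => tangentKnot_lt_succ (Nat.lt_of_succ_le h)

lemma tangentKnot_mem_Icc {k : ℕ} (hm : 0 < m) (hk : k ≤ m) : tangentKnot m k ∈ Icc (0 : ℝ) 1 :=
  ⟨(strictMonoOn_tangentKnot m).monotoneOn (mem_Iic.2 m.zero_le) hk k.zero_le,
    tangentKnot_self hm ▸ (strictMonoOn_tangentKnot m).monotoneOn hk (mem_Iic.2 le_rfl) hk⟩

lemma Icc_tangentKnot_subset {k : ℕ} (hk : k < m) :
    Icc (tangentKnot m k) (tangentKnot m (k + 1)) ⊆ Icc 0 1 :=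
  have hm : 0 < m := k.zero_le.trans_lt hk
  Icc_subset_Icc (tangentKnot_mem_Icc hm hk.le).1 (tangentKnot_mem_Icc hm hk).2

lemma Ioo_tangentKnot_subset {k : ℕ} (hk : k < m) :
    Ioo (tangentKnot m k) (tangentKnot m (k + 1)) ⊆ Ioo 0 1 :=
  have hm : 0 < m := k.zero_le.trans_lt hk
  Ioo_subset_Ioo (tangentKnot_mem_Icc hm hk.le).1 (tangentKnot_mem_Icc hm hk).2

lemma tangentKnot_succ_mem_Ioo {k : ℕ} (hk : k + 1 < m) : tangentKnot m (k + 1) ∈ Ioo (0 : ℝ) 1 :=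
  ⟨(tangentKnot_mem_Icc (by omega) (by omega : k ≤ m)).1.trans_lt (tangentKnot_lt_succ (by omega)),
    (tangentKnot_lt_succ hk).trans_le (tangentKnot_mem_Icc (by omega) hk).2⟩

lemma cos_arcAngle_sub_add_half_le {j k : ℕ} (hj : j < m) (hk : k < m) :
    cos (arcAngle m j - arcAngle m (k + 1 / 2)) ≤ cos (arcAngle m (1 / 2)) := by
  have hm : 0 < m := k.zero_le.trans_lt hk
  have hj' := arcAngle_mem_Ico j.cast_nonneg (Nat.cast_lt (α := ℝ).2 hj)
  have hk' : arcAngle m (k + 1 / 2) ∈ Icc 0 (π / 2) :=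
    arcAngle_mem_Icc (by positivity) (natCast_add_half_lt hk).le
  have hη := arcAngle_mem_Ico (by norm_num) (half_lt_natCast hm)
  rw [← cos_abs (_ - _)]
  refine cos_le_cos_of_nonneg_of_le_pi hη.1 (abs_le.2 ⟨?_, ?_⟩) (le_abs.2 ?_)
  · linarith [hj'.1, hk'.2, pi_pos]
  · linarith [hj'.2, hk'.1, pi_pos]
  · rw [← arcAngle_sub, neg_eq_zero_sub, ← arcAngle_zero m, ← arcAngle_sub]
    rcases le_or_gt j k with hjk | hjk
    · right
      refine (strictMono_arcAngle hm).monotone ?_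
      linarith [(mod_cast hjk : (j : ℝ) ≤ k)]
    · left
      refine (strictMono_arcAngle hm).monotone ?_
      linarith [(mod_cast hjk : (k : ℝ) + 1 ≤ j)]

lemma circleTangent_tangentKnot_succ {k : ℕ} (hk : k < m) :
    circleTangent (arcAngle m k) (tangentKnot m (k + 1)) =
      1 - cos (arcAngle m (k + 1 / 2)) / cos (arcAngle m (1 / 2)) := by
  rw [tangentKnot, circleTangent_sin_div_cos_eq_iff (cos_arcAngle_natCast_pos hk)
    (cos_arcAngle_half_pos (k.zero_le.trans_lt hk)), arcAngle_add, sub_add_cancel_left, cos_neg]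

lemma circleTangent_succ_tangentKnot_succ {k : ℕ} (hk : k + 1 < m) :
    circleTangent (arcAngle m (k + 1 : ℕ)) (tangentKnot m (k + 1)) =
      1 - cos (arcAngle m (k + 1 / 2)) / cos (arcAngle m (1 / 2)) := by
  rw [tangentKnot, circleTangent_sin_div_cos_eq_iff (cos_arcAngle_natCast_pos hk)
    (cos_arcAngle_half_pos (by omega)), ← arcAngle_sub]
  push_cast
  ring_nf

lemma circleTangent_tangentKnot_succ_le {j k : ℕ} (hj : j < m) (hk : k < m) :
    circleTangent (arcAngle m j) (tangentKnot m (k + 1)) ≤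
      1 - cos (arcAngle m (k + 1 / 2)) / cos (arcAngle m (1 / 2)) := by
  rw [tangentKnot, circleTangent_sin_div_cos_le_iff (cos_arcAngle_natCast_pos hj)
    (cos_arcAngle_half_pos (k.zero_le.trans_lt hk))]
  exact cos_arcAngle_sub_add_half_le hj hk

lemma circleTangent_le_of_mem_Icc_tangentKnot {j k : ℕ} (hj : j < m) (hk : k < m) {x : ℝ}
    (hx : x ∈ Icc (tangentKnot m k) (tangentKnot m (k + 1))) :
    circleTangent (arcAngle m j) x ≤ circleTangent (arcAngle m k) x := by
  have hleft : circleTangent (arcAngle m j) (tangentKnot m k) ≤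
      circleTangent (arcAngle m k) (tangentKnot m k) := by
    cases k with
    | zero =>
      simpa [tangentKnot, arcAngle_zero, circleTangent_zero] using
        circleTangent_sin_le (cos_arcAngle_natCast_pos hj) 0
    | succ k =>
      exact (circleTangent_tangentKnot_succ_le hj (by omega)).trans_eq
        (circleTangent_succ_tangentKnot_succ hk).symm
  have hright : circleTangent (arcAngle m j) (tangentKnot m (k + 1)) ≤
      circleTangent (arcAngle m k) (tangentKnot m (k + 1)) :=
    (circleTangent_tangentKnot_succ_le hj hk).trans_eq (circleTangent_tangentKnot_succ hk).symm
  unfold circleTangent at *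
  rcases le_total (tan (arcAngle m j)) (tan (arcAngle m k)) with h | h
  · nlinarith [mul_nonneg (sub_nonneg.2 h) (sub_nonneg.2 hx.1)]
  · nlinarith [mul_nonneg (sub_nonneg.2 h) (sub_nonneg.2 hx.2)]

/-! ### The tangent polygon -/

/-- The upper envelope of the tangents at the vertices `0, …, m - 1`. The tangent at the vertex `m`
is vertical. -/
def tangentEnvelope (m : ℕ) (x : ℝ) : ℝ := ⨆ k : Fin m, circleTangent (arcAngle m k) x

/-- The tangent polygon as a curve ending at `(1, 1)`: the jump at `1` is its side on `x = 1`. -/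
def tangentCurve (m : ℕ) : ℝ → ℝ := Function.update (tangentEnvelope m) 1 1

/-- The area under the tangent polygon. Each side contributes its horizontal length times the
ordinate of its point of contact, which is the midpoint of the side (for the first side the
ordinate is `0`). -/
def tangentIntegral (m : ℕ) : ℝ :=
  ∑ k ∈ Finset.range m, (tangentKnot m (k + 1) - tangentKnot m k) * (1 - cos (arcAngle m k))

lemma circleTangent_le_tangentEnvelope {k : ℕ} (hk : k < m) (x : ℝ) :
    circleTangent (arcAngle m k) x ≤ tangentEnvelope m x :=
  le_ciSup (f := fun j : Fin m => circleTangent (arcAngle m j) x) (finite_range _).bddAbove ⟨k, hk⟩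

lemma tangentEnvelope_le (hm : 0 < m) {x y : ℝ}
    (h : ∀ k < m, circleTangent (arcAngle m k) x ≤ y) : tangentEnvelope m x ≤ y :=
  have : Nonempty (Fin m) := ⟨⟨0, hm⟩⟩
  ciSup_le fun k => h k k.2

lemma tangentEnvelope_sin_le (hm : 0 < m) (φ : ℝ) : tangentEnvelope m (sin φ) ≤ 1 - cos φ :=
  tangentEnvelope_le hm fun _ hk => circleTangent_sin_le (cos_arcAngle_natCast_pos hk) φ

lemma convexOn_tangentEnvelope (hm : 0 < m) {S : Set ℝ} (hS : Convex ℝ S) :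
    ConvexOn ℝ S (tangentEnvelope m) :=
  have : Nonempty (Fin m) := ⟨⟨0, hm⟩⟩
  convexOn_iSup_of_finite fun k : Fin m => convexOn_circleTangent (arcAngle m k) hS

lemma tangentCurve_sin {k : ℕ} (hm : 0 < m) (hk : k ≤ m) :
    tangentCurve m (sin (arcAngle m k)) = 1 - cos (arcAngle m k) := by
  rcases hk.eq_or_lt with rfl | hk
  · simp [tangentCurve, arcAngle_self hm]
  · rw [tangentCurve, Function.update_of_ne (sin_arcAngle_natCast_mem_Ico hk).2.ne]
    refine (tangentEnvelope_sin_le hm _).antisymm ?_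
    exact (circleTangent_sin_self _).symm.trans_le (circleTangent_le_tangentEnvelope hk _)

lemma isLorenzCurve_tangentCurve (hm : 0 < m) : IsLorenzCurve (tangentCurve m) := by
  have hone : tangentEnvelope m 1 ≤ 1 := by simpa using tangentEnvelope_sin_le hm (π / 2)
  refine ⟨?_, fun x _ => ?_, ?_, Function.update_self ..⟩
  · refine convexOn_update_of_mem_extremePoints (convexOn_tangentEnvelope hm
      (convex_Icc 0 1)) ?_ hone
    simp [extremePoints_Icc zero_le_one]
  · calc (0 : ℝ) = circleTangent (arcAngle m (0 : ℕ)) x := by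
          rw [Nat.cast_zero, arcAngle_zero, circleTangent_zero]
      _ ≤ tangentEnvelope m x := circleTangent_le_tangentEnvelope hm x
      _ ≤ tangentCurve m x := le_update_self_iff.2 hone x
  · simpa [arcAngle_zero] using tangentCurve_sin hm m.zero_le

lemma tangentCurve_le_circleTangent {k : ℕ} (hk : k < m) {x : ℝ}
    (hx : x ∈ Ioo (tangentKnot m k) (tangentKnot m (k + 1))) :
    tangentCurve m x ≤ circleTangent (arcAngle m k) x := by
  rw [tangentCurve, Function.update_of_ne (Ioo_tangentKnot_subset hk hx).2.ne]
  exact tangentEnvelope_le (k.zero_le.trans_lt hk) fun j hj =>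
    circleTangent_le_of_mem_Icc_tangentKnot hj hk (Ioo_subset_Icc_self hx)

lemma integral_affine_tangentKnot {k : ℕ} (hk : k < m) {σ : ℝ} (hσ : k = 0 → σ = 0) (y : ℝ) :
    ∫ x in tangentKnot m k..tangentKnot m (k + 1), (y + σ * (x - sin (arcAngle m k))) =
      (tangentKnot m (k + 1) - tangentKnot m k) * y := by
  rcases eq_or_ne k 0 with hk0 | hk0
  · simp [hσ hk0]
  · rw [← midpoint_tangentKnot (k.zero_le.trans_lt hk) hk0, integral_affine_midpoint]

lemma integral_circleTangent {k : ℕ} (hk : k < m) :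
    ∫ x in tangentKnot m k..tangentKnot m (k + 1), circleTangent (arcAngle m k) x =
      (tangentKnot m (k + 1) - tangentKnot m k) * (1 - cos (arcAngle m k)) :=
  integral_affine_tangentKnot hk (by rintro rfl; simp [arcAngle_zero]) _

lemma IsLorenzCurve.intervalIntegrable_tangentKnot {L : ℝ → ℝ} (hL : IsLorenzCurve L) {k : ℕ}
    (hk : k < m) : IntervalIntegrable L volume (tangentKnot m k) (tangentKnot m (k + 1)) :=
  have hm : 0 < m := k.zero_le.trans_lt hk
  hL.intervalIntegrable (tangentKnot_mem_Icc hm hk.le) (tangentKnot_mem_Icc hm hk)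

lemma IsLorenzCurve.sum_integral_tangentKnot {L : ℝ → ℝ} (hL : IsLorenzCurve L) (hm : 0 < m) :
    ∑ k ∈ Finset.range m, ∫ x in tangentKnot m k..tangentKnot m (k + 1), L x =
      ∫ x in (0 : ℝ)..1, L x := by
  rw [intervalIntegral.sum_integral_adjacent_intervals (a := tangentKnot m) fun k hk =>
    hL.intervalIntegrable_tangentKnot hk, tangentKnot_self hm, tangentKnot]

lemma integral_tangentCurve_le (hm : 0 < m) :
    ∫ x in (0 : ℝ)..1, tangentCurve m x ≤ tangentIntegral m := by
  have hT := isLorenzCurve_tangentCurve hm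
  rw [← hT.sum_integral_tangentKnot hm, tangentIntegral]
  refine Finset.sum_le_sum fun k hk => ?_
  rw [Finset.mem_range] at hk
  rw [← integral_circleTangent hk]
  exact intervalIntegral.integral_mono_on_of_le_Ioo (tangentKnot_lt_succ hk).le
    (hT.intervalIntegrable_tangentKnot hk) ((continuous_circleTangent _).intervalIntegrable _ _)
    fun x hx => tangentCurve_le_circleTangent hk hx

/-! ### Convex curves through the vertices -/

section ThroughVertices

variable {L : ℝ → ℝ} (hL : IsLorenzCurve L)
  (hv : ∀ k < m, L (sin (arcAngle m k)) = 1 - cos (arcAngle m k))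

include hL hv

lemma exists_affine_le_of_vertices {k : ℕ} (hk : k < m) :
    ∃ σ : ℝ, (k = 0 → σ = 0) ∧
      ∀ x ∈ Icc (0 : ℝ) 1, 1 - cos (arcAngle m k) + σ * (x - sin (arcAngle m k)) ≤ L x := by
  obtain ⟨σ, hσ0, hσ⟩ := hL.exists_affine_le (sin_arcAngle_natCast_mem_Ico hk)
  rw [hv k hk] at hσ
  exact ⟨σ, by rintro rfl; exact hσ0 (by simp [arcAngle_zero]), hσ⟩

lemma mul_le_integral_tangentKnot {k : ℕ} (hk : k < m) :
    (tangentKnot m (k + 1) - tangentKnot m k) * (1 - cos (arcAngle m k)) ≤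
      ∫ x in tangentKnot m k..tangentKnot m (k + 1), L x := by
  obtain ⟨σ, hσ0, hσ⟩ := exists_affine_le_of_vertices hL hv hk
  rw [← integral_affine_tangentKnot hk hσ0]
  exact intervalIntegral.integral_mono_on (tangentKnot_lt_succ hk).le
    (Continuous.intervalIntegrable (by fun_prop) _ _) (hL.intervalIntegrable_tangentKnot hk)
    fun x hx => hσ x (Icc_tangentKnot_subset hk hx)

lemma tangentIntegral_le_integral (hm : 0 < m) :
    tangentIntegral m ≤ ∫ x in (0 : ℝ)..1, L x := by
  rw [← hL.sum_integral_tangentKnot hm]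
  exact Finset.sum_le_sum fun k hk => mul_le_integral_tangentKnot hL hv (Finset.mem_range.1 hk)

lemma exists_eqOn_affine_of_integral_le (hint : ∫ x in (0 : ℝ)..1, L x ≤ tangentIntegral m)
    {k : ℕ} (hk : k < m) :
    ∃ σ : ℝ, (k = 0 → σ = 0) ∧
      EqOn L (fun x => 1 - cos (arcAngle m k) + σ * (x - sin (arcAngle m k)))
        (Ioo (tangentKnot m k) (tangentKnot m (k + 1))) := by
  have hm : 0 < m := k.zero_le.trans_lt hk
  have hsum := (tangentIntegral_le_integral hL hv hm).antisymm hint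
  rw [← hL.sum_integral_tangentKnot hm, tangentIntegral, Finset.sum_eq_sum_iff_of_le
    fun k hk => mul_le_integral_tangentKnot hL hv (Finset.mem_range.1 hk)] at hsum
  obtain ⟨σ, hσ0, hσ⟩ := exists_affine_le_of_vertices hL hv hk
  refine ⟨σ, hσ0, (eqOn_Ioo_of_le_of_integral_le (tangentKnot_lt_succ hk).le (by fun_prop)
    (hL.continuousOn.mono (Ioo_tangentKnot_subset hk))
    (Continuous.intervalIntegrable (by fun_prop) _ _) (hL.intervalIntegrable_tangentKnot hk)
    (fun x hx => hσ x (Icc_tangentKnot_subset hk (Ioo_subset_Icc_self hx))) ?_).symm⟩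
  rw [integral_affine_tangentKnot hk hσ0, hsum k (Finset.mem_range.2 hk)]

lemma eqOn_circleTangent_of_integral_le (hint : ∫ x in (0 : ℝ)..1, L x ≤ tangentIntegral m)
    {k : ℕ} (hk : k < m) :
    EqOn L (circleTangent (arcAngle m k)) (Ioo (tangentKnot m k) (tangentKnot m (k + 1))) := by
  induction k with
  | zero =>
    obtain ⟨σ, hσ0, hσ⟩ := exists_eqOn_affine_of_integral_le hL hv hint hk
    exact fun x hx => by simpa [hσ0 rfl, arcAngle_zero, circleTangent_zero] using hσ hx
  | succ k ih =>
    obtain ⟨σ, -, hσ⟩ := exists_eqOn_affine_of_integral_le hL hv hint hk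
    have hk' : k < m := k.lt_succ_self.trans hk
    have hcorner := eq_of_eqOn_Ioo_of_continuousAt (tangentKnot_lt_succ hk')
      (tangentKnot_lt_succ hk)
      (hL.continuousOn.continuousAt (isOpen_Ioo.mem_nhds (tangentKnot_succ_mem_Ioo hk)))
      (continuous_circleTangent _).continuousAt (by fun_prop) (ih hk') hσ
    rw [circleTangent_tangentKnot_succ hk', ← circleTangent_succ_tangentKnot_succ hk,
      circleTangent, add_right_inj, mul_eq_mul_right_iff] at hcorner
    have hne : tangentKnot m (k + 1) - sin (arcAngle m (k + 1 : ℕ)) ≠ 0 := by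
      have hmid := midpoint_tangentKnot (k.zero_le.trans_lt hk') k.succ_ne_zero
      linarith [tangentKnot_lt_succ hk]
    rwa [← hcorner.resolve_right hne] at hσ

end ThroughVertices

/-! ### The quarter of a regular polygon -/

lemma periodic_regularVertex (n : ℕ) : Function.Periodic (regularVertex n) n := fun k => by
  rcases eq_or_ne n 0 with rfl | hn
  · rfl
  have hangle : 2 * π * (k + n : ℕ) / n = 2 * π * k / n + 2 * π := by
    push_cast
    field_simp
  simp only [regularVertex, hangle, sin_add_two_pi, cos_add_two_pi]

section RegularArc

variable {n : ℕ} {L : ℝ → ℝ} (hn : 4 ∣ n)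

include hn

lemma regularVertex_eq_arcAngle (k : ℕ) :
    regularVertex n k = (sin (arcAngle (n / 4) k), 1 - cos (arcAngle (n / 4) k)) := by
  have hangle : 2 * π * k / n = arcAngle (n / 4) k := by
    rw [arcAngle, Nat.cast_div_charZero hn]
    push_cast
    ring
  rw [regularVertex, hangle]

lemma regularArc_eq_arcAngle (i : Fin (n / 4 + 1)) :
    regularArc n i = (sin (arcAngle (n / 4) i), 1 - cos (arcAngle (n / 4) i)) :=
  regularVertex_eq_arcAngle hn i

lemma isCircumscribed_regularArc_iff : IsCircumscribed (regularArc n) L ↔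
    IsLorenzCurve L ∧ ∀ k ≤ n / 4,
      L (sin (arcAngle (n / 4) k)) = 1 - cos (arcAngle (n / 4) k) := by
  simp only [IsCircumscribed, regularArc_eq_arcAngle hn, Fin.forall_iff, Nat.lt_succ_iff]

variable (hm : 0 < n / 4)

include hm

lemma range_regularVertex_inter_Icc :
    range (regularVertex n) ∩ Icc ((0, 0) : ℝ × ℝ) (1, 1) = range (regularArc n) := by
  apply Subset.antisymm
  · rintro _ ⟨⟨k, rfl⟩, hk⟩
    rw [← (periodic_regularVertex n).map_mod_nat] at hk ⊢
    have hkn : ((k % n : ℕ) : ℝ) < (n / 4 : ℕ) * 4 := by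
      exact_mod_cast (Nat.mod_lt k (by omega)).trans_eq (Nat.div_mul_cancel hn).symm
    rw [regularVertex_eq_arcAngle hn, mem_Icc, Prod.mk_le_mk, Prod.mk_le_mk] at hk
    have hlt : arcAngle (n / 4) (k % n : ℕ) < 2 * π := by
      calc arcAngle (n / 4) (k % n : ℕ) < arcAngle (n / 4) ((n / 4 : ℕ) * 4) :=
            strictMono_arcAngle hm hkn
        _ = 4 * arcAngle (n / 4) (n / 4 : ℕ) := by simp only [arcAngle]; ring
        _ = 2 * π := by rw [arcAngle_self hm]; ring
    have hle := le_pi_div_two_of_sin_nonneg_of_cos_nonneg hlt hk.1.1 (by linarith [hk.2.2])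
    rw [← arcAngle_self hm, (strictMono_arcAngle hm).le_iff_le, Nat.cast_le] at hle
    exact ⟨⟨k % n, Nat.lt_succ_of_le hle⟩, rfl⟩
  · rintro _ ⟨i, rfl⟩
    have hi := Nat.lt_succ_iff.1 i.2
    refine ⟨⟨i, rfl⟩, ?_⟩
    rw [regularArc_eq_arcAngle hn, mem_Icc, Prod.mk_le_mk, Prod.mk_le_mk]
    exact ⟨⟨sin_arcAngle_natCast_nonneg hi, sub_nonneg.2 (cos_le_one _)⟩, sin_le_one _,
      sub_le_self 1 (cos_arcAngle_natCast_nonneg hi)⟩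

lemma strictMono_fst_regularArc : StrictMono fun i => (regularArc n i).1 := fun i j hij => by
  have hi := arcAngle_natCast_mem_Icc (Nat.lt_succ_iff.1 i.2)
  have hj := arcAngle_natCast_mem_Icc (Nat.lt_succ_iff.1 j.2)
  simp only [regularArc_eq_arcAngle hn]
  exact sin_lt_sin_of_lt_of_le_pi_div_two (by linarith [hi.1, pi_pos]) hj.2
    (strictMono_arcAngle hm (Nat.cast_lt.2 hij))

lemma sideSlope_regularArc (i : Fin (n / 4)) :
    sideSlope (regularArc n) i = tan (arcAngle (n / 4) (i + 1 / 2)) := by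
  have hhalf : (arcAngle (n / 4) (i + 1 : ℕ) - arcAngle (n / 4) i) / 2 =
      arcAngle (n / 4) (1 / 2) := by
    simp only [arcAngle]
    push_cast
    ring
  simp only [sideSlope, regularArc_eq_arcAngle hn, Fin.val_succ, Fin.val_castSucc]
  rw [one_sub_cos_sub_div_sin_sub (hhalf ▸ (sin_arcAngle_half_pos hm).ne')]
  simp only [arcAngle]
  push_cast
  ring_nf

lemma isLorenzData_regularArc : IsLorenzData (regularArc n) where
  first := by simp [regularArc_eq_arcAngle hn, arcAngle_zero]
  last := by simp [regularArc_eq_arcAngle hn, arcAngle_self hm]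
  nonneg i := by
    rw [regularArc_eq_arcAngle hn]
    exact sub_nonneg.2 (cos_le_one _)
  strictMono_fst := strictMono_fst_regularArc hn hm
  strictMono_slope i j hij := by
    rw [sideSlope_regularArc hn hm, sideSlope_regularArc hn hm]
    refine strictMonoOn_tan (arcAngle_mem_Ioo_neg (by positivity) (natCast_add_half_lt i.2))
      (arcAngle_mem_Ioo_neg (by positivity) (natCast_add_half_lt j.2)) (strictMono_arcAngle hm ?_)
    gcongr
    exact_mod_cast hij

lemma isCircumscribed_tangentCurve : IsCircumscribed (regularArc n) (tangentCurve (n / 4)) :=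
  (isCircumscribed_regularArc_iff hn).2
    ⟨isLorenzCurve_tangentCurve hm, fun _ hk => tangentCurve_sin hm hk⟩

lemma isOptimal_tangentCurve : IsOptimal (regularArc n) (tangentCurve (n / 4)) := by
  refine ⟨isCircumscribed_tangentCurve hn hm, fun M hM => ?_⟩
  obtain ⟨hM, hv⟩ := (isCircumscribed_regularArc_iff hn).1 hM
  rw [hM.gini_eq, (isLorenzCurve_tangentCurve hm).gini_eq]
  linarith [integral_tangentCurve_le hm,
    tangentIntegral_le_integral hM (fun k hk => hv k hk.le) hm]

variable (hL : IsOptimal (regularArc n) L)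

include hL

lemma IsOptimal.eqOn_circleTangent {k : ℕ} (hk : k < n / 4) :
    EqOn L (circleTangent (arcAngle (n / 4) k))
      (Ioo (tangentKnot (n / 4) k) (tangentKnot (n / 4) (k + 1))) := by
  obtain ⟨hLor, hv⟩ := (isCircumscribed_regularArc_iff hn).1 hL.1
  have hgini := hL.2 _ (isCircumscribed_tangentCurve hn hm)
  rw [hLor.gini_eq, (isLorenzCurve_tangentCurve hm).gini_eq] at hgini
  exact eqOn_circleTangent_of_integral_le hLor (fun k hk => hv k hk.le)
    (by linarith [integral_tangentCurve_le hm]) hk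

lemma IsOptimal.eq_mul_add {k : ℕ} (hk : k < n / 4) :
    ∃ c, ∀ x ∈ Ioo (tangentKnot (n / 4) k) (tangentKnot (n / 4) (k + 1)),
      L x = tan (arcAngle (n / 4) k) * x + c := by
  refine ⟨circleTangent (arcAngle (n / 4) k) 0, fun x hx => ?_⟩
  rw [hL.eqOn_circleTangent hn hm hk hx, circleTangent, circleTangent]
  ring

lemma IsOptimal.isPolygonal : IsPolygonal L :=
  ⟨n / 4, tangentKnot (n / 4), rfl, tangentKnot_self hm, fun _ hk =>
    ⟨tangentKnot_lt_succ hk, _, hL.eq_mul_add hn hm hk⟩⟩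

lemma IsOptimal.not_used (i : Fin (n / 4)) : ¬ Used (regularArc n) L i := fun hu => by
  have hfst := strictMono_fst_regularArc hn hm i.castSucc_lt_succ
  obtain ⟨x, hx⟩ := exists_between (sin_arcAngle_lt_tangentKnot_succ i.2)
  have hxL := hL.eqOn_circleTangent hn hm i.2
    ⟨(tangentKnot_le_sin_arcAngle i.2.le).trans_lt hx.1, hx.2⟩
  have hxr : x ≤ sin (arcAngle (n / 4) (i + 1 : ℕ)) :=
    hx.2.le.trans (tangentKnot_le_sin_arcAngle i.2)
  rw [hu.apply_eq hfst (by simpa [regularArc_eq_arcAngle hn] using ⟨hx.1.le, by simpa using hxr⟩),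
    sideSlope_regularArc hn hm, circleTangent] at hxL
  simp only [regularArc_eq_arcAngle hn, Fin.val_castSucc, add_right_inj, mul_eq_mul_right_iff]
    at hxL
  exact tan_arcAngle_add_half_ne i.2 i.2 (hxL.resolve_right (sub_pos.2 hx.1).ne')

end RegularArc

lemma IsOptimal.hasConsecutiveN {n : ℕ} {L : ℝ → ℝ} (hL : IsOptimal (regularArc n) L)
    (hn : 4 ∣ n) (hm : 2 ≤ n / 4) : HasConsecutiveN (regularArc n) L :=
  have hm0 : 0 < n / 4 := Nat.zero_lt_of_lt hm
  ⟨⟨0, hm0⟩, ⟨1, hm⟩, rfl, hL.not_used hn hm0 _, hL.not_used hn hm0 _⟩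

lemma IsOptimal.not_sidesOnSidelines {n : ℕ} {L : ℝ → ℝ} (hL : IsOptimal (regularArc n) L)
    (hn : 4 ∣ n) (hm : 2 ≤ n / 4) : ¬ SidesOnSidelines (regularArc n) L := by
  intro hside
  have hm0 : 0 < n / 4 := Nat.zero_lt_of_lt hm
  obtain ⟨c, hc⟩ := hL.eq_mul_add hn hm0 (k := 1) hm
  have htan : 0 < tan (arcAngle (n / 4) (1 : ℕ)) := tan_pos_of_pos_of_lt_pi_div_two
    (arcAngle_zero (n / 4) ▸ strictMono_arcAngle hm0 (by simp))
    (arcAngle_mem_Ico (Nat.cast_nonneg 1) (Nat.cast_lt.2 hm)).2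
  rcases hside _ _ _ c (tangentKnot_mem_Icc hm0 hm0).1 (tangentKnot_lt_succ hm)
    (tangentKnot_mem_Icc hm0 hm).2 hc with ⟨hs, -⟩ | ⟨i, hleft, hright⟩
  · exact htan.ne' hs
  · have hslope := sideSlope_eq_of_line
      (strictMono_fst_regularArc hn hm0 i.castSucc_lt_succ) hleft hright
    rw [sideSlope_regularArc hn hm0] at hslope
    exact tan_arcAngle_add_half_ne i.2 hm hslope

end

theorem mainTheorem7_general :
    ¬ FarrisConjectureSidelines ∧ ¬ FarrisConjectureSequences ∧
    ∀ n : ℕ, 8 ≤ n → 4 ∣ n →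
      range (regularVertex n) ∩ Icc ((0, 0) : ℝ × ℝ) (1, 1) = range (regularArc n) ∧
      IsLorenzData (regularArc n) ∧
      (∃ L : ℝ → ℝ, IsOptimal (regularArc n) L) ∧
      ∀ L : ℝ → ℝ, IsOptimal (regularArc n) L →
        IsPolygonal L ∧ (∀ i, ¬ Used (regularArc n) L i) ∧
        HasConsecutiveN (regularArc n) L ∧ ¬ SidesOnSidelines (regularArc n) L := by
  have hn : 4 ∣ 8 := by norm_num
  have hdata := isLorenzData_regularArc hn (by norm_num)
  refine ⟨fun hconj => ?_, fun hconj => ?_, fun n h8 hn => ?_⟩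
  · obtain ⟨L, hL, -, hsides⟩ := hconj _ _ hdata
    exact hL.not_sidesOnSidelines hn (by norm_num) hsides
  · obtain ⟨L, hL, -, hseq⟩ := hconj _ _ hdata
    exact hseq (hL.hasConsecutiveN hn (by norm_num))
  · have hm : 0 < n / 4 := by omega
    have hm2 : 2 ≤ n / 4 := by omega
    exact ⟨range_regularVertex_inter_Icc hn hm, isLorenzData_regularArc hn hm,
      ⟨_, isOptimal_tangentCurve hn hm⟩, fun L hL => ⟨hL.isPolygonal hn hm, hL.not_used hn hm,
        hL.hasConsecutiveN hn hm2, hL.not_sidesOnSidelines hn hm2⟩⟩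

theorem mainTheorem7 :
    ¬ FarrisConjectureSidelines ∧ ¬ FarrisConjectureSequences ∧
    ∀ n : ℕ, 5 ≤ n → 8 ∣ n - 4 →
      range (regularVertex n) ∩ Icc ((0, 0) : ℝ × ℝ) (1, 1) = range (regularArc n) ∧
      IsLorenzData (regularArc n) ∧
      (∃ L : ℝ → ℝ, IsOptimal (regularArc n) L) ∧
      ∀ L : ℝ → ℝ, IsOptimal (regularArc n) L →
        IsPolygonal L ∧ (∀ i, ¬ Used (regularArc n) L i) ∧
        HasConsecutiveN (regularArc n) L ∧ ¬ SidesOnSidelines (regularArc n) L := by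
  obtain ⟨hsides, hseq, hopt⟩ := mainTheorem7_general
  exact ⟨hsides, hseq, fun n h5 h8 => hopt n (by omega) (by omega)⟩
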